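/- Let $M$ be a smooth $n$-dimensional manifold and $\tau\colon E\to M$ a smooth real vector bundle of finite rank with a Lie algebroid structure: a smooth vector bundle map $\rho\colon E\to TM$ over the identity (the anchor) and a real Lie bracket on the smooth sections of $E$ with $[\sigma,f\eta]=f[\sigma,\eta]+(\rho(\sigma)f)\,\eta$. Let $\mathcal T^EE\to E$ be the prolongation of $E$, the Lie algebroid with fibre $\mathcal T^E_aE=\{(b,v)\in E_{\tau(a)}\times T_aE : \rho(b)=T_a\tau(v)\}$ at $a\in E$, with anchor $(b,v)\mapsto v$ and with bracket $[(\sigma_1,X_1),(\sigma_2,X_2)]=([\sigma_1,\sigma_2],[X_1,X_2])$ on projectable sections (those of the form $a\mapsto(\sigma(\tau(a)),X(a))$ with $\sigma$ a section of $E$ and $X$ a vector field on $E$). Let $d$ be its exterior differential; for a function $f$ on $E$ one has $df(b,v)=v(f)$. Write $b^V_a\in T_aE$ for the vertical lift of $b\in E_{\tau(a)}$ at $a$, $S(a,b,v)=(a,0,b^V_a)$ for the vertical endomorphism and $\Delta(a)=(a,0,a^V_a)$ for the Liouville section. For a smooth function $L\colon E\to\mathbb R$ put $\theta_L=S^*(dL)$,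 $\omega_L=-d\theta_L$ and $E_L=dL(\Delta)-L$. Let $D\subset E$ be a smooth vector subbundle with annihilator $D^\circ\subset E^*$, let $\mathcal T^D_aD=\{(b,v)\in\mathcal T^E_aE : b\in D_{\tau(a)},\ v\in T_aD\}$ for $a\in D$, and let $(\mathcal T^D_aD)^\perp\subset\mathcal T^E_aE$ be its $\omega_L$-orthogonal complement. The Lagrange–d'Alembert equations at $a\in D$, for an element $z\in\mathcal T^E_aE$, are $$z\in\mathcal T^D_aD,\qquad Sz=\Delta(a),\qquad \omega_L(z,(b,v))-dE_L(b,v)=\lambda(b)\ \text{ for some }\lambda\in D^\circ_{\tau(a)}\text{ and all }(b,v)\in\mathcal T^E_aE .$$ A solution of the constrained system $(L,D)$ is a smooth section $\Gamma$ of $\mathcal T^DD$ over $D$ whose value $\Gamma(a)$ satisfies these equations at every $a\in D$ (in particular, $\Gamma$ is a SODE). The system $(L,D)$ is called regular if it has a solution $\Gamma$ and, for every $a\in D$, $\Gamma(a)$ is the only element of $\mathcal T^E_aE$ satisfying the equations at $a$. Theorem. Suppose that $L$ is regular on an open neighbourhood $U$ of $D$ in $E$ (that is, $\omega_L$ is nondegenerate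 at every point of $U$), that $(L,D)$ is regular, and that $\Gamma_L$ is the solution of the free dynamics on $U$, i.e. the smooth section of $\mathcal T^EE$ over $U$ with $i_{\Gamma_L}\omega_L=dE_L$. Then for every $a\in D$ $$\mathcal T^E_aE=\mathcal T^D_aD\oplus(\mathcal T^D_aD)^\perp ,$$ and, if $\bar P_a\colon\mathcal T^E_aE\to\mathcal T^D_aD$ denotes the projector along $(\mathcal T^D_aD)^\perp$, the section $a\mapsto\bar P_a(\Gamma_L(a))$ of $\mathcal T^DD$ is a solution of the constrained system $(L,D)$, in particular a SODE, and every solution $\Gamma_{(L,D)}$ of $(L,D)$ satisfies $\Gamma_{(L,D)}=\bar P(\Gamma_L|_D)$ on $D$. -/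

import Mathlib

open Bundle Manifold ContDiff Topology Set

noncomputable section

namespace Nonholonomic

/-- The model with corners of the total space of a vector bundle with typical fibre `F` over an
`n`-dimensional manifold. -/
abbrev totalModel (n : ℕ) (F : Type*) [NormedAddCommGroup F] [NormedSpace ℝ F] :
    ModelWithCorners ℝ (EuclideanSpace ℝ (Fin n) × F)
      (ModelProd (EuclideanSpace ℝ (Fin n)) F) :=
  (𝓡 n).prod 𝓘(ℝ, F)

section Setup

variable (n : ℕ) (F : Type*) [NormedAddCommGroup F] [NormedSpace ℝ F]
  {M : Type*} [TopologicalSpace M] [ChartedSpace (EuclideanSpace ℝ (Fin n)) M]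
  [IsManifold (𝓡 n) ∞ M]
  (E : M → Type*) [∀ x, AddCommGroup (E x)] [∀ x, Module ℝ (E x)]
  [∀ x, TopologicalSpace (E x)] [TopologicalSpace (TotalSpace F E)]
  [FiberBundle F E] [VectorBundle ℝ F E] [ContMDiffVectorBundle ∞ F E (𝓡 n)]

/-- The smooth sections of the vector bundle `E`. -/
abbrev Sec := ContMDiffSection (𝓡 n) F ∞ E

/-- A Lie algebroid structure on the vector bundle `τ : E → M`: a smooth vector bundle map
`ρ : E → TM` over the identity and a real Lie algebra structure on the space of smooth sections
such that `[σ, f η] = f [σ, η] + (ρ(σ) f) η`. -/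
structure LieAlgebroid where
  /-- the anchor `ρ` -/
  anchor : ∀ x, E x →ₗ[ℝ] TangentSpace (𝓡 n) x
  contMDiff_anchor : ContMDiff (totalModel n F) (𝓡 n).tangent ∞
    (fun a : TotalSpace F E => (⟨a.1, anchor a.1 a.2⟩ : TangentBundle (𝓡 n) M))
  /-- the bracket of sections -/
  bracket : Sec n F E →ₗ[ℝ] Sec n F E →ₗ[ℝ] Sec n F E
  bracket_self : ∀ σ, bracket σ σ = 0
  jacobi : ∀ σ η ζ,
    bracket σ (bracket η ζ) = bracket (bracket σ η) ζ + bracket η (bracket σ ζ)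
  leibniz : ∀ (f : M → ℝ), ContMDiff (𝓡 n) 𝓘(ℝ, ℝ) ∞ f → ∀ σ η fη : Sec n F E,
    (∀ x, fη x = f x • η x) →
      ∀ x, bracket σ fη x = f x • bracket σ η x + mvfderiv (𝓡 n) f x (anchor x (σ x)) • η x

/-- The fibre at `a ∈ E` of the bundle `τ^*E ⊕ TE` over `E`, that is, the space of pairs `(b, v)`
with `b ∈ E_{τ(a)}` and `v ∈ T_a E`. The prolongation `T^E E` is a subbundle of it. -/
abbrev Pair (a : TotalSpace F E) : Type _ := E a.1 × TangentSpace (totalModel n F) a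

variable {F E}

/-- The vertical lift `b^V_a ∈ T_a E`: the velocity at `t = 0` of the curve `t ↦ a + t b` in the
fibre of `a`. -/
def verticalLift (a : TotalSpace F E) (b : E a.1) : TangentSpace (totalModel n F) a :=
  mfderiv 𝓘(ℝ, ℝ) (totalModel n F) (fun t : ℝ => (⟨a.1, a.2 + t • b⟩ : TotalSpace F E)) 0 (1 : ℝ)

/-- The vertical endomorphism `S(a, b, v) = (a, 0, b^V_a)`. -/
def vertEndo (a : TotalSpace F E) (z : Pair n F E a) : Pair n F E a := (0, verticalLift n a z.1)

/-- The Liouville section `Δ(a) = (a, 0, a^V_a)`. -/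
def liouville (a : TotalSpace F E) : Pair n F E a := (0, verticalLift n a a.2)

/-- The differential `df` of a function `f` on `E`, as a one-form on the prolongation:
`df(b, v) = v f`. -/
def dFun (f : TotalSpace F E → ℝ) (a : TotalSpace F E) (z : Pair n F E a) : ℝ :=
  mvfderiv (totalModel n F) f a z.2

/-- The energy `E_L = d_Δ L - L`. -/
def energy (L : TotalSpace F E → ℝ) (a : TotalSpace F E) : ℝ := dFun n L a (liouville n a) - L a

/-- The Cartan one-form `θ_L = S^*(dL)`. -/
def cartanOneForm (L : TotalSpace F E → ℝ) (a : TotalSpace F E) (z : Pair n F E a) : ℝ :=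
  dFun n L a (vertEndo n a z)

/-- A smooth subbundle of `E`: near every point of `M` it is spanned by linearly independent
smooth local sections of `E`. -/
def IsSmoothSubbundle (D : ∀ x, Submodule ℝ (E x)) : Prop :=
  ∀ x₀ : M, ∃ U : Set M, IsOpen U ∧ x₀ ∈ U ∧ ∃ (k : ℕ) (s : Fin k → ∀ x, E x),
    (∀ i, ContMDiffOn (𝓡 n) (totalModel n F) ∞
      (fun x => (⟨x, s i x⟩ : TotalSpace F E)) U) ∧
    ∀ x ∈ U, LinearIndependent ℝ (fun i => s i x) ∧
      Submodule.span ℝ (Set.range fun i => s i x) = D x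

variable (F) in
/-- The total space of a family of subspaces `D x ⊆ E x`, as a subset of the total space of `E`. -/
def totalSet (D : ∀ x, Submodule ℝ (E x)) : Set (TotalSpace F E) := {a | a.2 ∈ D a.1}

/-- The tangent space `T_a D ⊆ T_a E` at a point `a` of the submanifold `D` of `E`: the vectors
that annihilate every function smooth near `a` and vanishing on `D` near `a`. -/
def tangentTo (D : ∀ x, Submodule ℝ (E x)) (a : TotalSpace F E) :
    Submodule ℝ (TangentSpace (totalModel n F) a) where
  carrier := {v | ∀ f : TotalSpace F E → ℝ, ContMDiffAt (totalModel n F) 𝓘(ℝ, ℝ) ∞ f a →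
    (∀ᶠ c in 𝓝[totalSet F D] a, f c = 0) → mvfderiv (totalModel n F) f a v = 0}
  zero_mem' := fun f _ _ => map_zero _
  add_mem' := fun hv hw f h₁ h₂ => by rw [map_add, hv f h₁ h₂, hw f h₁ h₂, add_zero]
  smul_mem' := fun c v hv f h₁ h₂ => by rw [map_smul, hv f h₁ h₂, smul_zero]

variable {n}

/-- The fibre at `a ∈ E` of the prolongation `T^E E`: the pairs `(b, v)` with
`b ∈ E_{τ(a)}`, `v ∈ T_a E` and `ρ(b) = T_a τ(v)`. -/
def prolong (A : LieAlgebroid n F E) (a : TotalSpace F E) : Submodule ℝ (Pair n F E a) where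
  carrier := {z | A.anchor a.1 z.1 =
    mfderiv (totalModel n F) (𝓡 n) (TotalSpace.proj : TotalSpace F E → M) a z.2}
  zero_mem' := by
    change A.anchor a.1 0 = mfderiv (totalModel n F) (𝓡 n) TotalSpace.proj a 0
    rw [map_zero, map_zero]
  add_mem' := by
    intro z w hz hw
    change A.anchor a.1 (z.1 + w.1) =
      mfderiv (totalModel n F) (𝓡 n) TotalSpace.proj a (z.2 + w.2)
    rw [map_add, map_add]
    exact congrArg₂ (· + ·) hz hw
  smul_mem' := by
    intro c z hz
    change A.anchor a.1 (c • z.1) = mfderiv (totalModel n F) (𝓡 n) TotalSpace.proj a (c • z.2)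
    rw [map_smul, map_smul]
    exact congrArg (c • ·) hz

/-- A projectable section `a ↦ (a, σ(τ(a)), X(a))` of `T^E E`: a smooth section `σ` of `E` and a
smooth vector field `X` on `E` that projects to `ρ(σ)`. -/
structure ProjSection (A : LieAlgebroid n F E) where
  base : Sec n F E
  field : ∀ a : TotalSpace F E, TangentSpace (totalModel n F) a
  contMDiff_field : ContMDiff (totalModel n F) (totalModel n F).tangent ∞
    (fun a => (⟨a, field a⟩ : TangentBundle (totalModel n F) (TotalSpace F E)))
  mem_prolong : ∀ a, (base a.1, field a) ∈ prolong A a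

/-- The value of a projectable section. -/
def ProjSection.val {A : LieAlgebroid n F E} (Z : ProjSection A) (a : TotalSpace F E) :
    prolong A a := ⟨(Z.base a.1, Z.field a), Z.mem_prolong a⟩

/-- The bracket of projectable sections of the Lie algebroid `T^E E`:
`[Z₁, Z₂](a) = (a, [σ₁, σ₂](τ(a)), [X₁, X₂](a))`. -/
def projBracket {A : LieAlgebroid n F E} (Z₁ Z₂ : ProjSection A) (a : TotalSpace F E) :
    Pair n F E a :=
  (A.bracket Z₁.base Z₂.base a.1,
    VectorField.mlieBracket (totalModel n F) Z₁.field Z₂.field a)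

/-- The value at `a` of `dθ(Z₁, Z₂) = ρ¹(Z₁)(θ(Z₂)) - ρ¹(Z₂)(θ(Z₁)) - θ([Z₁, Z₂])`, for a
one-form `θ` and projectable sections `Z₁`, `Z₂` of the Lie algebroid `T^E E`, whose anchor is
`ρ¹(a, b, v) = v`. -/
def dOneForm {A : LieAlgebroid n F E} (θ : ∀ a : TotalSpace F E, Pair n F E a → ℝ)
    (Z₁ Z₂ : ProjSection A) (a : TotalSpace F E) : ℝ :=
  mvfderiv (totalModel n F) (fun c => θ c (Z₂.val c)) a (Z₁.field a)
    - mvfderiv (totalModel n F) (fun c => θ c (Z₁.val c)) a (Z₂.field a)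
    - θ a (projBracket Z₁ Z₂ a)

open Classical in
/-- The Cartan two-form `ω_L = -dθ_L` at `a`: the bilinear form on the fibre of `T^E E` at `a`
that is given on the values of projectable sections (which exhaust the fibre) by the exterior
differential of the Lie algebroid `T^E E`. -/
def cartanTwoForm (A : LieAlgebroid n F E) (L : TotalSpace F E → ℝ) (a : TotalSpace F E) :
    LinearMap.BilinForm ℝ (prolong A a) :=
  if h : ∃ B : LinearMap.BilinForm ℝ (prolong A a), ∀ Z₁ Z₂ : ProjSection A,
      B (Z₁.val a) (Z₂.val a) = -dOneForm (cartanOneForm n L) Z₁ Z₂ a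
  then h.choose else 0

/-- The fibre at `a ∈ D` of `T^D D`, as a subspace of the fibre of `T^E E`: the elements `(b, v)`
with `b ∈ D` and `v` tangent to `D`. -/
def prolongConstr (A : LieAlgebroid n F E) (D : ∀ x, Submodule ℝ (E x)) (a : TotalSpace F E) :
    Submodule ℝ (prolong A a) :=
  ((D a.1).prod (tangentTo n D a)).comap (prolong A a).subtype

/-- The `ω_L`-orthogonal complement `(T^D D)^⊥` at `a`. -/
def prolongPerp (A : LieAlgebroid n F E) (L : TotalSpace F E → ℝ) (D : ∀ x, Submodule ℝ (E x))
    (a : TotalSpace F E) : Submodule ℝ (prolong A a) :=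
  (cartanTwoForm A L a).orthogonal (prolongConstr A D a)

open Classical in
/-- The projector `P̄_a` of the fibre of `T^E E` onto that of `T^D D` along `(T^D D)^⊥`
(zero when these two subspaces are not complementary). -/
def projector (A : LieAlgebroid n F E) (L : TotalSpace F E → ℝ) (D : ∀ x, Submodule ℝ (E x))
    (a : TotalSpace F E) : prolong A a →ₗ[ℝ] prolong A a :=
  if h : IsCompl (prolongConstr A D a) (prolongPerp A L D a)
  then (prolongConstr A D a).projection (prolongPerp A L D a) h else 0

/-- Smoothness on a set `s ⊆ E` of a section of `T^E E`, as a map into `E ×_M TE`. -/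
def IsSmoothOn (A : LieAlgebroid n F E) (s : Set (TotalSpace F E))
    (Γ : ∀ a : TotalSpace F E, prolong A a) : Prop :=
  ContMDiffOn (totalModel n F) (totalModel n F) ∞
    (fun a => (⟨a.1, (Γ a).1.1⟩ : TotalSpace F E)) s ∧
  ContMDiffOn (totalModel n F) (totalModel n F).tangent ∞
    (fun a => (⟨a, (Γ a).1.2⟩ : TangentBundle (totalModel n F) (TotalSpace F E))) s

/-- `Γ` is a smooth solution on `U` of the free dynamics `i_Γ ω_L = dE_L`. -/
def IsFreeSolution (A : LieAlgebroid n F E) (L : TotalSpace F E → ℝ) (U : Set (TotalSpace F E))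
    (Γ : ∀ a : TotalSpace F E, prolong A a) : Prop :=
  IsSmoothOn A U Γ ∧
  ∀ a ∈ U, ∀ u : prolong A a, cartanTwoForm A L a (Γ a) u = dFun n (energy n L) a u

/-- The Lagrange-d'Alembert equations at the point `a ∈ D`, for the value `z` at `a` of a second
order section: `S z = Δ(a)`, the form `i_z ω_L - dE_L(a)` is the pullback to `T^E E` of an element
of the annihilator of `D`, and `z ∈ T^D D`. -/
def LagrangeDAlembertAt (A : LieAlgebroid n F E) (L : TotalSpace F E → ℝ)
    (D : ∀ x, Submodule ℝ (E x)) (a : TotalSpace F E) (z : prolong A a) : Prop :=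
  vertEndo n a z = liouville n a ∧
  (∃ l ∈ (D a.1).dualAnnihilator, ∀ u : prolong A a,
    cartanTwoForm A L a z u - dFun n (energy n L) a u = l u.1.1) ∧
  z ∈ prolongConstr A D a

/-- `Γ` is a solution of the constrained system `(L, D)`: along `D` it is a smooth second order
section of `T^D D` that satisfies the Lagrange-d'Alembert equations. Only the values of `Γ` on `D`
matter. -/
def IsConstrainedSolution (A : LieAlgebroid n F E) (L : TotalSpace F E → ℝ)
    (D : ∀ x, Submodule ℝ (E x)) (Γ : ∀ a : TotalSpace F E, prolong A a) : Prop :=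
  IsSmoothOn A (totalSet F D) Γ ∧ ∀ a ∈ totalSet F D, LagrangeDAlembertAt A L D a (Γ a)

/-- The constrained system `(L, D)` is regular: the Lagrange-d'Alembert equations have a solution,
and it is unique in the sense that at every point `a ∈ D` its value is the only element that
satisfies the equations at `a` (they are algebraic in the value of the section). -/
def IsRegularSystem (A : LieAlgebroid n F E) (L : TotalSpace F E → ℝ)
    (D : ∀ x, Submodule ℝ (E x)) : Prop :=
  ∃ Γ : ∀ a : TotalSpace F E, prolong A a, IsConstrainedSolution A L D Γ ∧
    ∀ a ∈ totalSet F D, ∀ z : prolong A a, LagrangeDAlembertAt A L D a z → z = Γ a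

end Setup

end Nonholonomic

end

set_option linter.unusedSectionVars false

noncomputable section

namespace Nonholonomic

variable {n : ℕ} {F : Type*} [NormedAddCommGroup F] [NormedSpace ℝ F]
  {M : Type*} [TopologicalSpace M] [ChartedSpace (EuclideanSpace ℝ (Fin n)) M]
  [IsManifold (𝓡 n) ∞ M]
  {E : M → Type*} [∀ x, AddCommGroup (E x)] [∀ x, Module ℝ (E x)]
  [∀ x, TopologicalSpace (E x)] [TopologicalSpace (TotalSpace F E)]
  [FiberBundle F E] [VectorBundle ℝ F E] [ContMDiffVectorBundle ∞ F E (𝓡 n)]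

/-! Write `V(w)` for the vertical element `(0, w^V)` at `a ∈ D`. The form `ω_L` is antisymmetric and
vanishes on pairs of vertical elements (`cartanTwoForm_swap`, `cartanTwoForm_vertical`), so
`ω_L(V(w), u)` depends only on the `E`-component of `u`. Since `T^D D` projects onto `D`, this
induces a linear map `G` from `D_{τ(a)}` to its dual.

If `G w = 0`, the contraction of `ω_L` with `V(w)` is the pullback of an element of `D°`. Adding
`V(w)` to a solution `z₀` of the Lagrange-d'Alembert equations then changes only the multiplier, and
pointwise uniqueness forces `w = 0` (`eq_zero_of_vertical_orthogonal`). So `G` is injective, hence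
bijective.

Let `z` lie in `T^D D` and in its orthogonal complement. Pairing `z` with all `V(w)`, `w ∈ D`, and
using surjectivity of `G` gives that `z` is vertical; being tangent to `D`, it is some `V(w)` with
`w ∈ D` (`mem_of_verticalLift_mem_tangentTo`); injectivity of `G` then gives `z = 0`. For a
reflexive form in finite dimension, trivial intersection already gives the direct sum
(`isCompl_prolongConstr`).

Subtracting the free equations from the constrained ones shows that `Γ_L - Γ` pairs with `T^D D`
through `D°`, so it is orthogonal to `T^D D`, and projecting gives `P̄ Γ_L = Γ`
(`projector_freeSolution`). -/

/-! ### Vertical lifts and the tangent bundle of `E` in a trivialization. -/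

theorem mdifferentiableAt_trivialization (e : Trivialization F (π F E)) [MemTrivializationAtlas e]
    {a : TotalSpace F E} (ha : a.1 ∈ e.baseSet) :
    MDifferentiableAt (totalModel n F) (totalModel n F) e a :=
  ((e.contMDiffOn (IB := 𝓡 n) (n := ∞)).contMDiffAt
    (e.open_source.mem_nhds (e.mem_source.2 ha))).mdifferentiableAt (by simp)

theorem mdifferentiableAt_trivialization_symm (e : Trivialization F (π F E))
    [MemTrivializationAtlas e] {p : M × F} (hp : p.1 ∈ e.baseSet) :
    MDifferentiableAt (totalModel n F) (totalModel n F) e.toOpenPartialHomeomorph.symm p :=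
  ((e.contMDiffOn_symm (IB := 𝓡 n) (n := ∞)).contMDiffAt
    (e.open_target.mem_nhds (e.mem_target.2 hp))).mdifferentiableAt (by simp)

/-- The derivative of the inverse of a trivialization, as a map into the tangent space at `a`. -/
def trivLift (n : ℕ) {F : Type*} [NormedAddCommGroup F] [NormedSpace ℝ F]
  {M : Type*} [TopologicalSpace M] [ChartedSpace (EuclideanSpace ℝ (Fin n)) M]
  {E : M → Type*} [∀ x, TopologicalSpace (E x)] [TopologicalSpace (TotalSpace F E)]
  [FiberBundle F E]
  (e : Trivialization F (π F E)) (a : TotalSpace F E) :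
    (TangentSpace (𝓡 n) a.1 × F) →ₗ[ℝ] TangentSpace (totalModel n F) a :=
  (mfderiv (totalModel n F) (totalModel n F) e.toOpenPartialHomeomorph.symm (a.1, (e a).2)).toLinearMap

theorem trivLift_mfderiv (e : Trivialization F (π F E)) [MemTrivializationAtlas e]
    {a : TotalSpace F E} (ha : a.1 ∈ e.baseSet) (v : TangentSpace (totalModel n F) a) :
    trivLift n e a (mfderiv (totalModel n F) (totalModel n F) e a v) = v := by
  have h1 := e.mk_proj_snd (e.mem_source.2 ha)
  have h2 : (mfderiv (totalModel n F) (totalModel n F)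
      (e.toOpenPartialHomeomorph.symm ∘ e) a) v = v := by
    have : (e.toOpenPartialHomeomorph.symm ∘ e) =ᶠ[𝓝 a] id := by
      filter_upwards [e.open_source.mem_nhds (e.mem_source.2 ha)] with c hc
      exact e.toOpenPartialHomeomorph.left_inv hc
    rw [this.mfderiv_eq, mfderiv_id]
    rfl
  rw [mfderiv_comp a (mdifferentiableAt_trivialization_symm e (by rwa [← h1]))
    (mdifferentiableAt_trivialization e ha)] at h2
  unfold trivLift
  rw [h1]
  exact h2

theorem mfderiv_trivLift (e : Trivialization F (π F E)) [MemTrivializationAtlas e]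
    {a : TotalSpace F E} (ha : a.1 ∈ e.baseSet) (w : TangentSpace (𝓡 n) a.1 × F) :
    mfderiv (totalModel n F) (totalModel n F) e a (trivLift n e a w) = w := by
  have h0 : e.toOpenPartialHomeomorph.symm (a.1, (e a).2) = a := by
    rw [e.mk_proj_snd (e.mem_source.2 ha)]
    exact e.toOpenPartialHomeomorph.left_inv (e.mem_source.2 ha)
  have h2 : (mfderiv (totalModel n F) (totalModel n F)
      (e ∘ e.toOpenPartialHomeomorph.symm) (a.1, (e a).2)) w = w := by
    have : (e ∘ e.toOpenPartialHomeomorph.symm) =ᶠ[𝓝 (a.1, (e a).2)] id := by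
      filter_upwards [e.open_target.mem_nhds (e.mem_target.2 (show (a.1, (e a).2).1 ∈ e.baseSet from ha))] with c hc
      exact e.toOpenPartialHomeomorph.right_inv hc
    rw [this.mfderiv_eq, mfderiv_id]
    rfl
  exact (mfderiv_comp_apply_of_eq (a.1, (e a).2) (mdifferentiableAt_trivialization e ha)
    (mdifferentiableAt_trivialization_symm e (p := (a.1, (e a).2)) ha) h0 w).symm.trans h2

theorem mfderiv_proj_eq_fst (e : Trivialization F (π F E)) [MemTrivializationAtlas e]
    {a : TotalSpace F E} (ha : a.1 ∈ e.baseSet) (v : TangentSpace (totalModel n F) a) :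
    mfderiv (totalModel n F) (𝓡 n) (TotalSpace.proj : TotalSpace F E → M) a v =
      (mfderiv (totalModel n F) (totalModel n F) e a v).1 := by
  have : (TotalSpace.proj : TotalSpace F E → M) =ᶠ[𝓝 a] Prod.fst ∘ e := by
    filter_upwards [e.open_source.mem_nhds (e.mem_source.2 ha)] with c hc
    exact (e.coe_fst hc).symm
  rw [this.mfderiv_eq, mfderiv_comp a mdifferentiableAt_fst (mdifferentiableAt_trivialization e ha),
    mfderiv_fst]
  rfl

theorem mfderiv_proj_trivLift (e : Trivialization F (π F E)) [MemTrivializationAtlas e]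
    {a : TotalSpace F E} (ha : a.1 ∈ e.baseSet) (w : TangentSpace (𝓡 n) a.1 × F) :
    mfderiv (totalModel n F) (𝓡 n) (TotalSpace.proj : TotalSpace F E → M) a (trivLift n e a w) =
      w.1 := by
  rw [mfderiv_proj_eq_fst e ha, mfderiv_trivLift e ha]

theorem fiberCurve_eq (e : Trivialization F (π F E)) [MemTrivializationAtlas e]
    {a : TotalSpace F E} (ha : a.1 ∈ e.baseSet) (b : E a.1) :
    (fun t : ℝ => (⟨a.1, a.2 + t • b⟩ : TotalSpace F E)) =
      fun t : ℝ => e.toOpenPartialHomeomorph.symm (a.1, (e a).2 + t • e.linearMapAt ℝ a.1 b) := by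
  funext t
  have hs : (⟨a.1, a.2 + t • b⟩ : TotalSpace F E) ∈ e.source := e.mem_source.2 ha
  refine (e.toOpenPartialHomeomorph.left_inv hs).symm.trans (congrArg _ ?_)
  refine (e.mk_proj_snd hs).symm.trans (Prod.ext rfl ?_)
  have h4 := fun y : E a.1 => congrFun (e.coe_linearMapAt_of_mem (R := ℝ) ha) y
  have : (e a).2 = e.linearMapAt ℝ a.1 a.2 := (h4 a.2).symm
  simp only [this, ← h4, ← map_smul, ← map_add]

/-- In a trivialization the fibre curve is the affine line `t ↦ (x, y + t d)`, with velocity `(0,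
d)`. This makes the vertical lift linear and injective. -/
theorem verticalLift_eq_trivLift_aux (e : Trivialization F (π F E)) [MemTrivializationAtlas e]
    {a : TotalSpace F E} (ha : a.1 ∈ e.baseSet) (b : E a.1) :
    MDifferentiableAt 𝓘(ℝ, ℝ) (totalModel n F)
      (fun t : ℝ => (⟨a.1, a.2 + t • b⟩ : TotalSpace F E)) 0 ∧
    verticalLift n a b = trivLift n e a (0, e.linearMapAt ℝ a.1 b) := by
  set d := e.linearMapAt ℝ a.1 b
  have h1 : HasMFDerivAt 𝓘(ℝ, ℝ) 𝓘(ℝ, F) (fun t : ℝ => (e a).2 + t • d) 0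
      ((ContinuousLinearMap.id ℝ ℝ).smulRight d) := by
    exact (((hasFDerivAt_id (0 : ℝ)).smul_const d).const_add (e a).2).hasMFDerivAt
  have h2 : HasMFDerivAt 𝓘(ℝ, ℝ) (totalModel n F) (fun t : ℝ => (a.1, (e a).2 + t • d)) 0 _ :=
    (hasMFDerivAt_const (I' := 𝓡 n) a.1 (0 : ℝ)).prodMk h1
  have h3 := mdifferentiableAt_trivialization_symm (n := n) e (p := (a.1, (e a).2)) ha
  have hp : (fun t : ℝ => (a.1, (e a).2 + t • d)) 0 = (a.1, (e a).2) := by simp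
  have h4 := mfderiv_comp_apply_of_eq (0 : ℝ) h3 h2.mdifferentiableAt hp (1 : ℝ)
  rw [fiberCurve_eq e ha b]
  refine ⟨h3.comp_of_eq (0 : ℝ) h2.mdifferentiableAt hp, ?_⟩
  unfold verticalLift
  rw [fiberCurve_eq e ha b]
  refine h4.trans ?_
  rw [h2.mfderiv]
  unfold trivLift
  change (mfderiv (totalModel n F) (totalModel n F) e.toOpenPartialHomeomorph.symm (a.1, (e a).2))
    ((0 : TangentSpace (𝓡 n) a.1), (1 : ℝ) • d) = _
  rw [one_smul]
  rfl

theorem mdifferentiableAt_fiberCurve (a : TotalSpace F E) (b : E a.1) :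
    MDifferentiableAt 𝓘(ℝ, ℝ) (totalModel n F)
      (fun t : ℝ => (⟨a.1, a.2 + t • b⟩ : TotalSpace F E)) 0 :=
  (verticalLift_eq_trivLift_aux _ (FiberBundle.mem_baseSet_trivializationAt' a.1) b).1

theorem verticalLift_eq_trivLift (e : Trivialization F (π F E)) [MemTrivializationAtlas e]
    {a : TotalSpace F E} (ha : a.1 ∈ e.baseSet) (b : E a.1) :
    verticalLift n a b = trivLift n e a (0, e.linearMapAt ℝ a.1 b) :=
  (verticalLift_eq_trivLift_aux e ha b).2

variable (n) in
/-- The vertical lift at `a` as a linear map. -/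
def verticalLiftₗ (a : TotalSpace F E) : E a.1 →ₗ[ℝ] TangentSpace (totalModel n F) a :=
  (trivLift n (trivializationAt F E a.1) a ∘ₗ LinearMap.inr ℝ (TangentSpace (𝓡 n) a.1) F) ∘ₗ
    (trivializationAt F E a.1).linearMapAt ℝ a.1

theorem verticalLiftₗ_apply (a : TotalSpace F E) (b : E a.1) :
    verticalLiftₗ n a b = verticalLift n a b :=
  (verticalLift_eq_trivLift _ (FiberBundle.mem_baseSet_trivializationAt' a.1) b).symm

theorem verticalLift_injective (a : TotalSpace F E) :
    Function.Injective (verticalLift n a) := by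
  intro b c h
  have ha := FiberBundle.mem_baseSet_trivializationAt' (F := F) (E := E) a.1
  rw [verticalLift_eq_trivLift _ ha, verticalLift_eq_trivLift _ ha] at h
  have h2 := congrArg (mfderiv (totalModel n F) (totalModel n F) (trivializationAt F E a.1) a) h
  rw [mfderiv_trivLift _ ha, mfderiv_trivLift _ ha] at h2
  have h3 := congrArg Prod.snd h2
  exact ((trivializationAt F E a.1).linearEquivAt ℝ a.1 ha).injective (by
    simpa [Trivialization.coe_linearMapAt_of_mem _ ha] using h3)

theorem mfderiv_proj_verticalLift (a : TotalSpace F E) (b : E a.1) :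
    mfderiv (totalModel n F) (𝓡 n) (TotalSpace.proj : TotalSpace F E → M) a
      (verticalLift n a b) = 0 := by
  have ha := FiberBundle.mem_baseSet_trivializationAt' (F := F) (E := E) a.1
  rw [verticalLift_eq_trivLift _ ha, mfderiv_proj_trivLift _ ha]

theorem exists_verticalLift_eq (a : TotalSpace F E) (v : TangentSpace (totalModel n F) a)
    (hv : mfderiv (totalModel n F) (𝓡 n) (TotalSpace.proj : TotalSpace F E → M) a v = 0) :
    ∃ b, verticalLift n a b = v := by
  have ha := FiberBundle.mem_baseSet_trivializationAt' (F := F) (E := E) a.1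
  rw [mfderiv_proj_eq_fst _ ha] at hv
  refine ⟨(trivializationAt F E a.1).symm a.1
    (mfderiv (totalModel n F) (totalModel n F) (trivializationAt F E a.1) a v).2, ?_⟩
  rw [verticalLift_eq_trivLift _ ha, Trivialization.coe_linearMapAt_of_mem _ ha]
  conv_rhs => rw [← trivLift_mfderiv _ ha v]
  refine congrArg _ (Prod.ext hv.symm ?_)
  change ((trivializationAt F E a.1) ⟨a.1, (trivializationAt F E a.1).symm a.1 _⟩).2 = _
  rw [Trivialization.apply_mk_symm _ ha]

/-! ### Projectable sections with a prescribed value. -/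

theorem exists_bump [T2Space M] (x : M) {s : Set M} (hs : s ∈ 𝓝 x) :
    ∃ χ : M → ℝ, ContMDiff (𝓡 n) 𝓘(ℝ, ℝ) ∞ χ ∧ tsupport χ ⊆ s ∧ χ x = 1 := by
  obtain ⟨f, -, hf⟩ := ((SmoothBumpFunction.nhds_basis_tsupport (I := 𝓡 n) x).mem_iff).1 hs
  exact ⟨f, f.contMDiff, hf, f.eq_one⟩

/-- The local section of `E` that is constant in a trivialization. -/
theorem contMDiffOn_symm_const (e : Trivialization F (π F E)) [MemTrivializationAtlas e] (f : F) :
    ContMDiffOn (𝓡 n) (totalModel n F) ∞ (fun y => (⟨y, e.symm y f⟩ : TotalSpace F E))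
      e.baseSet := by
  have h := (e.contMDiffOn_symm (IB := 𝓡 n) (n := ∞)).comp
    (contMDiffOn_id.prodMk (contMDiffOn_const (c := f)))
    (s := e.baseSet) (fun y hy => e.mem_target.2 hy)
  refine h.congr fun y hy => ?_
  exact (e.mk_symm hy f)

theorem tangentBundle_mk_eq {a a' : TotalSpace F E} (h : a = a')
    {v : TangentSpace (totalModel n F) a} {v' : TangentSpace (totalModel n F) a'}
    (hv : (show EuclideanSpace ℝ (Fin n) × F from v) = v') :
    (⟨a, v⟩ : TangentBundle (totalModel n F) (TotalSpace F E)) = ⟨a', v'⟩ := by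
  subst h
  exact congrArg _ hv

/-- The field is the tangent map of the inverse trivialization applied to the product of a smooth
field along `M` and a constant field on `F`. -/
theorem contMDiffOn_trivLift (A : LieAlgebroid n F E) (e : Trivialization F (π F E))
    [MemTrivializationAtlas e] (f g : F) :
    ContMDiffOn (totalModel n F) (totalModel n F).tangent ∞
      (fun c => (⟨c, trivLift n e c (A.anchor c.1 (e.symm c.1 f), g)⟩ :
        TangentBundle (totalModel n F) (TotalSpace F E))) e.source := by
  have hT := ContMDiffOn.contMDiffOn_tangentMapWithin (m := ∞)
    (e.contMDiffOn_symm (IB := 𝓡 n) (n := ∞)) (by simp) e.open_target.uniqueMDiffOn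
  have h1 : ContMDiffOn (totalModel n F) (𝓡 n).tangent ∞
      (fun c : TotalSpace F E => (⟨c.1, A.anchor c.1 (e.symm c.1 f)⟩ : TangentBundle (𝓡 n) M))
      e.source :=
    (A.contMDiff_anchor.comp_contMDiffOn (contMDiffOn_symm_const e f)).comp
      (contMDiffOn_proj E) (fun c hc => e.mem_source.1 hc)
  have h2 : ContMDiffOn (totalModel n F) 𝓘(ℝ, F).tangent ∞
      (fun c : TotalSpace F E => (⟨(e c).2, g⟩ : TangentBundle 𝓘(ℝ, F) F)) e.source := by
    have hc : ContMDiff 𝓘(ℝ, F) 𝓘(ℝ, F).tangent ∞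
        (fun y : F => (⟨y, g⟩ : TangentBundle 𝓘(ℝ, F) F)) :=
      contMDiff_vectorSpace_iff_contDiff.2 contDiff_const
    exact hc.comp_contMDiffOn (contMDiff_snd.comp_contMDiffOn
      (e.contMDiffOn (IB := 𝓡 n) (n := ∞)))
  have h3 := (contMDiff_equivTangentBundleProd_symm (n := ∞) (I := 𝓡 n) (M := M)
    (I' := 𝓘(ℝ, F)) (M' := F)).comp_contMDiffOn (h1.prodMk h2)
  have h4 := hT.comp h3 (fun c hc => e.mem_target.2 (e.mem_source.1 hc))
  refine h4.congr fun c hc => ?_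
  have hp : e c = (c.1, (e c).2) := (e.mk_proj_snd hc).symm
  refine tangentBundle_mk_eq ?_ ?_
  · exact ((congrArg _ hp.symm).trans (e.toOpenPartialHomeomorph.left_inv hc)).symm
  · dsimp only [Function.comp, equivTangentBundleProd, Equiv.coe_fn_symm_mk]
    have ht : ((c.1, (e c).2) : M × F) ∈ e.target := e.mem_target.2 (e.mem_source.1 hc)
    rw [mfderivWithin_of_isOpen e.open_target ht]
    rfl

/-- Components constant in a trivialization, cut off by a bump function, extend `z`; the `M`-part of
the field is taken to be the anchor of the base section, which makes it projectable. A vertical `z`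
has constant component `f = 0`, so its extension has zero base everywhere. -/
theorem exists_projSection [T2Space M] (A : LieAlgebroid n F E) (a : TotalSpace F E)
    (z : prolong A a) :
    ∃ Z : ProjSection A, Z.val a = z ∧ (z.1.1 = 0 → Z.base = 0) := by
  set e := trivializationAt F E a.1
  have ha : a.1 ∈ e.baseSet := FiberBundle.mem_baseSet_trivializationAt' a.1
  set f : F := e.linearMapAt ℝ a.1 z.1.1 with hf
  set g : F := (mfderiv (totalModel n F) (totalModel n F) e a z.1.2).2 with hg
  obtain ⟨χ, hχ, hχs, hχa⟩ := exists_bump (n := n) a.1 (e.open_baseSet.mem_nhds ha)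
  have hsm : e.symm a.1 f = z.1.1 := by
    rw [← Trivialization.symmₗ_apply (R := ℝ) e ha]
    exact e.symmₗ_linearMapAt (R := ℝ) ha z.1.1
  let σ : Sec n F E := ⟨fun y => χ y • e.symm y f,
    hχ.contMDiffOn.smul_section_of_tsupport e.open_baseSet hχs (contMDiffOn_symm_const e f)⟩
  have hχE : ContMDiff (totalModel n F) 𝓘(ℝ, ℝ) ∞ (fun c : TotalSpace F E => χ c.1) :=
    hχ.comp (contMDiff_proj E)
  have hsupp : tsupport (fun c : TotalSpace F E => χ c.1) ⊆ e.source := fun c hc =>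
    e.mem_source.2 (hχs (tsupport_comp_subset_preimage χ (FiberBundle.continuous_proj F E) hc))
  have hX := hχE.contMDiffOn.smul_section_of_tsupport e.open_source hsupp
    (contMDiffOn_trivLift A e f g)
  let Z : ProjSection A :=
    { base := σ
      field := fun c => χ c.1 • trivLift n e c (A.anchor c.1 (e.symm c.1 f), g)
      contMDiff_field := hX
      mem_prolong := fun c => by
        change A.anchor c.1 (χ c.1 • e.symm c.1 f) =
          mfderiv (totalModel n F) (𝓡 n) TotalSpace.proj c (χ c.1 • _)
        rw [map_smul, map_smul]
        -- `trivLift` is meaningful only over the trivialization; elsewhere `χ` vanishes and both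
        -- sides are zero.
        by_cases hc : χ c.1 = 0
        · rw [hc]; exact (zero_smul _ _).trans (zero_smul _ _).symm
        · have hc' : c.1 ∈ e.baseSet := hχs (subset_tsupport χ hc)
          rw [mfderiv_proj_trivLift e hc'] }
  refine ⟨Z, Subtype.ext (Prod.ext ?_ ?_), fun h0 => ?_⟩
  · change χ a.1 • e.symm a.1 f = z.1.1
    rw [hχa, one_smul, hsm]
  · change χ a.1 • trivLift n e a (A.anchor a.1 (e.symm a.1 f), g) = z.1.2
    rw [hχa, one_smul, hsm]
    conv_rhs => rw [← trivLift_mfderiv e ha z.1.2]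
    refine congrArg _ (Prod.ext ?_ rfl)
    exact (show A.anchor a.1 z.1.1 = _ from z.2).trans (mfderiv_proj_eq_fst e ha z.1.2)
  · refine ContMDiffSection.ext fun y => ?_
    change χ y • e.symm y f = 0
    have hf0 : f = 0 := by rw [hf, h0, map_zero]
    by_cases hy : χ y = 0
    · rw [hy, zero_smul]
    · rw [hf0, ← Trivialization.symmₗ_apply (R := ℝ) e (hχs (subset_tsupport χ hy)), map_zero, smul_zero]

/-! ### Antisymmetry of `ω_L` and its vanishing on vertical pairs. -/

theorem cartanOneForm_neg (L : TotalSpace F E → ℝ) (a : TotalSpace F E) (z : Pair n F E a) :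
    cartanOneForm n L a (-z) = -cartanOneForm n L a z := by
  unfold cartanOneForm dFun vertEndo
  change mvfderiv (totalModel n F) L a (verticalLift n a (-z.1)) =
    -mvfderiv (totalModel n F) L a (verticalLift n a z.1)
  rw [← verticalLiftₗ_apply, ← verticalLiftₗ_apply, map_neg, map_neg]

theorem cartanOneForm_of_fst_eq_zero (L : TotalSpace F E → ℝ) (a : TotalSpace F E)
    (z : Pair n F E a) (hz : z.1 = 0) : cartanOneForm n L a z = 0 := by
  unfold cartanOneForm dFun vertEndo
  change mvfderiv (totalModel n F) L a (verticalLift n a z.1) = 0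
  rw [hz, ← verticalLiftₗ_apply, map_zero, map_zero]

theorem LieAlgebroid.bracket_swap (A : LieAlgebroid n F E) (σ η : Sec n F E) :
    A.bracket σ η = -A.bracket η σ := by
  have h := A.bracket_self (σ + η)
  simp only [map_add, LinearMap.add_apply, A.bracket_self, zero_add, add_zero] at h
  exact eq_neg_of_add_eq_zero_right h

theorem projBracket_swap {A : LieAlgebroid n F E} (Z₁ Z₂ : ProjSection A) (a : TotalSpace F E) :
    projBracket Z₁ Z₂ a = -projBracket Z₂ Z₁ a := by
  unfold projBracket
  refine Prod.ext ?_ ?_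
  · change A.bracket Z₁.base Z₂.base a.1 = -A.bracket Z₂.base Z₁.base a.1
    rw [A.bracket_swap]
    rfl
  · exact VectorField.mlieBracket_swap_apply

theorem dOneForm_cartan_swap {A : LieAlgebroid n F E} (L : TotalSpace F E → ℝ)
    (Z₁ Z₂ : ProjSection A) (a : TotalSpace F E) :
    dOneForm (cartanOneForm n L) Z₁ Z₂ a = -dOneForm (cartanOneForm n L) Z₂ Z₁ a := by
  unfold dOneForm
  rw [projBracket_swap, cartanOneForm_neg]
  ring

/-- `θ_L` sees only the `E`-component, and the bracket of two sections with zero base has zero base,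
so each of the three terms vanishes. -/
theorem dOneForm_cartan_of_base_eq_zero {A : LieAlgebroid n F E} (L : TotalSpace F E → ℝ)
    (Z₁ Z₂ : ProjSection A) (h₁ : Z₁.base = 0) (h₂ : Z₂.base = 0) (a : TotalSpace F E) :
    dOneForm (cartanOneForm n L) Z₁ Z₂ a = 0 := by
  have key : ∀ Z : ProjSection A, Z.base = 0 →
      (fun c => cartanOneForm n L c (Z.val c)) = fun _ => (0 : ℝ) := fun Z hZ => by
    funext c
    refine cartanOneForm_of_fst_eq_zero L c _ ?_
    change Z.base c.1 = 0
    rw [hZ]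
    rfl
  have hb : cartanOneForm n L a (projBracket Z₁ Z₂ a) = 0 := by
    refine cartanOneForm_of_fst_eq_zero L a _ ?_
    change A.bracket Z₁.base Z₂.base a.1 = 0
    rw [h₁, map_zero]
    rfl
  unfold dOneForm
  rw [key Z₁ h₁, key Z₂ h₂, hb, mvfderiv_const]
  simp

/-- The fallback value `0` is harmless: antisymmetry and vanishing on vertical pairs hold in both
cases. -/
theorem cartanTwoForm_cases (A : LieAlgebroid n F E) (L : TotalSpace F E → ℝ)
    (a : TotalSpace F E) :
    (∀ Z₁ Z₂ : ProjSection A, cartanTwoForm A L a (Z₁.val a) (Z₂.val a) =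
      -dOneForm (cartanOneForm n L) Z₁ Z₂ a) ∨ cartanTwoForm A L a = 0 := by
  unfold cartanTwoForm
  split_ifs with h
  · exact Or.inl h.choose_spec
  · exact Or.inr rfl

theorem cartanTwoForm_swap [T2Space M] (A : LieAlgebroid n F E) (L : TotalSpace F E → ℝ)
    (a : TotalSpace F E) (z w : prolong A a) :
    cartanTwoForm A L a z w = -cartanTwoForm A L a w z := by
  rcases cartanTwoForm_cases A L a with h | h
  · obtain ⟨Z, rfl, -⟩ := exists_projSection A a z
    obtain ⟨W, rfl, -⟩ := exists_projSection A a w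
    rw [h, h, dOneForm_cartan_swap]
  · simp [h]

theorem cartanTwoForm_isRefl [T2Space M] (A : LieAlgebroid n F E) (L : TotalSpace F E → ℝ)
    (a : TotalSpace F E) : (cartanTwoForm A L a).IsRefl := fun z w h => by
  rw [cartanTwoForm_swap, h, neg_zero]

theorem cartanTwoForm_vertical [T2Space M] (A : LieAlgebroid n F E) (L : TotalSpace F E → ℝ)
    (a : TotalSpace F E) (z w : prolong A a) (hz : z.1.1 = 0) (hw : w.1.1 = 0) :
    cartanTwoForm A L a z w = 0 := by
  rcases cartanTwoForm_cases A L a with h | h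
  · obtain ⟨Z, rfl, hZ⟩ := exists_projSection A a z
    obtain ⟨W, rfl, hW⟩ := exists_projSection A a w
    rw [h, dOneForm_cartan_of_base_eq_zero L Z W (hZ hz) (hW hw), neg_zero]
  · simp [h]

/-! ### The tangent spaces of `D`. -/

variable {D : ∀ x, Submodule ℝ (E x)}

theorem mvfderiv_eq_zero_of_eventuallyEq_const {V H N : Type*} [NormedAddCommGroup V]
    [NormedSpace ℝ V] [TopologicalSpace H] {I : ModelWithCorners ℝ V H} [TopologicalSpace N]
    [ChartedSpace H N] {f : N → ℝ} {x : N} {c : ℝ} (h : f =ᶠ[𝓝 x] fun _ => c)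
    (v : TangentSpace I x) : mvfderiv I f x v = 0 := by
  unfold mvfderiv
  rw [h.mfderiv_eq, mfderiv_const]
  exact map_zero (NormedSpace.fromTangentSpace (𝕜 := ℝ) (f x))

theorem verticalLift_mem_tangentTo {a : TotalSpace F E} (ha : a.2 ∈ D a.1) {b : E a.1}
    (hb : b ∈ D a.1) : verticalLift n a b ∈ tangentTo n D a := by
  intro f hf hf0
  have hc := mdifferentiableAt_fiberCurve (n := n) a b
  have h0 : (fun t : ℝ => (⟨a.1, a.2 + t • b⟩ : TotalSpace F E)) 0 = a := by simp
  refine (mvfderiv_comp_apply_of_eq (0 : ℝ) (hf.mdifferentiableAt (by simp)) hc h0 1).symm.trans ?_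
  have hz : (f ∘ fun t : ℝ => (⟨a.1, a.2 + t • b⟩ : TotalSpace F E)) =ᶠ[𝓝 0] fun _ => (0 : ℝ) := by
    have ht : Filter.Tendsto (fun t : ℝ => (⟨a.1, a.2 + t • b⟩ : TotalSpace F E)) (𝓝 0)
        (𝓝[totalSet F D] a) := by
      refine tendsto_nhdsWithin_iff.2 ⟨?_, Filter.Eventually.of_forall fun t =>
        (D a.1).add_mem ha ((D a.1).smul_mem t hb)⟩
      simpa [h0] using hc.continuousAt.tendsto
    exact ht.eventually hf0
  exact mvfderiv_eq_zero_of_eventuallyEq_const hz _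

/-- A combination of a local frame of `D` with constant coefficients is a section through `a` with
image in `D`; its derivative lifts `u`. -/
theorem exists_mem_tangentTo (hD : IsSmoothSubbundle (F := F) n D) {a : TotalSpace F E}
    (ha : a.2 ∈ D a.1) (u : TangentSpace (𝓡 n) a.1) :
    ∃ v ∈ tangentTo n D a,
      mfderiv (totalModel n F) (𝓡 n) (TotalSpace.proj : TotalSpace F E → M) a v = u := by
  obtain ⟨U, hU, haU, k, s, hs, hsD⟩ := hD a.1
  obtain ⟨c, hc⟩ := (Submodule.mem_span_range_iff_exists_fun ℝ).1 ((hsD a.1 haU).2.symm ▸ ha)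
  set σ : M → TotalSpace F E := fun x => ⟨x, ∑ i, c i • s i x⟩ with hσ
  have hσU : ContMDiffOn (𝓡 n) (totalModel n F) ∞ σ U :=
    ContMDiffOn.sum_section fun i _ => (hs i).const_smul_section
  have hσa : σ a.1 = a := by rw [hσ]; simp [hc]
  have hσd : MDifferentiableAt (𝓡 n) (totalModel n F) σ a.1 :=
    (hσU.contMDiffAt (hU.mem_nhds haU)).mdifferentiableAt (by simp)
  refine ⟨mfderiv (𝓡 n) (totalModel n F) σ a.1 u, ?_, ?_⟩
  · intro f hf hf0
    refine (mvfderiv_comp_apply_of_eq a.1 (hf.mdifferentiableAt (by simp)) hσd hσa u).symm.trans ?_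
    have hz : (f ∘ σ) =ᶠ[𝓝 a.1] fun _ => (0 : ℝ) := by
      have ht : Filter.Tendsto σ (𝓝 a.1) (𝓝[totalSet F D] a) := by
        refine tendsto_nhdsWithin_iff.2 ⟨?_, ?_⟩
        · simpa [hσa] using hσd.continuousAt.tendsto
        · filter_upwards [hU.mem_nhds haU] with x hx
          change ∑ i, c i • s i x ∈ D x
          rw [← (hsD x hx).2]
          exact Submodule.sum_mem _ fun i _ =>
            Submodule.smul_mem _ _ (Submodule.subset_span ⟨i, rfl⟩)
      exact ht.eventually hf0
    exact mvfderiv_eq_zero_of_eventuallyEq_const hz u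
  · have hp : MDifferentiableAt (totalModel n F) (𝓡 n) (TotalSpace.proj : TotalSpace F E → M) a :=
      (contMDiffAt_proj (n := ∞) E).mdifferentiableAt (by simp)
    refine (mfderiv_comp_apply_of_eq a.1 hp hσd hσa u).symm.trans ?_
    have : (TotalSpace.proj : TotalSpace F E → M) ∘ σ = id := rfl
    rw [this, mfderiv_id]
    rfl

theorem contDiff_matrix_det (m : ℕ) :
    ContDiff ℝ ∞ (fun A : Fin m → Fin m → ℝ => Matrix.det (Matrix.of A)) := by
  simp only [Matrix.det_apply, Matrix.of_apply]
  fun_prop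

theorem exists_dual_family {k : ℕ} [FiniteDimensional ℝ F] {W : Fin k → F}
    (hW : LinearIndependent ℝ W) :
    ∃ Ψ : F →L[ℝ] (Fin k → ℝ), ∀ j, Ψ (W j) = Pi.single j 1 := by
  obtain ⟨Ψ, hΨ⟩ := LinearMap.exists_leftInverse_of_injective (Fintype.linearCombination ℝ W)
    (LinearMap.ker_eq_bot.2 hW.fintypeLinearCombination_injective)
  refine ⟨LinearMap.toContinuousLinearMap Ψ, fun j => ?_⟩
  have := LinearMap.congr_fun hΨ (Pi.single j 1)
  simpa using this

/-- If `b ∉ D`, a determinant measuring the dependence of `c` on a frame of `D` is a smooth function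
that vanishes on `D` near `a` and has derivative `1` along `b^V`. -/
theorem mem_of_verticalLift_mem_tangentTo [FiniteDimensional ℝ F]
    (hD : IsSmoothSubbundle (F := F) n D) {a : TotalSpace F E} {b : E a.1}
    (hb : verticalLift n a b ∈ tangentTo n D a) : b ∈ D a.1 := by
  by_contra hbD
  obtain ⟨U, hU, haU, k, s, hs, hsD⟩ := hD a.1
  set e := trivializationAt F E a.1
  have ha : a.1 ∈ e.baseSet := FiberBundle.mem_baseSet_trivializationAt' a.1
  have he : ∀ {x : M} (_ : x ∈ e.baseSet) (y : E x), (e ⟨x, y⟩).2 = e.linearMapAt ℝ x y :=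
    fun hx y => (congrFun (e.coe_linearMapAt_of_mem (R := ℝ) hx) y).symm
  set W : Fin (k + 1) → E a.1 := Fin.snoc (fun i => s i a.1) b with hWdef
  have hW : LinearIndependent ℝ W := by
    refine linearIndependent_finSnoc.2 ⟨(hsD a.1 haU).1, ?_⟩
    rwa [(hsD a.1 haU).2]
  have hWF : LinearIndependent ℝ fun j => e.linearMapAt ℝ a.1 (W j) := by
    refine hW.map' (e.linearMapAt ℝ a.1) (LinearMap.ker_eq_bot.2 ?_)
    rw [Trivialization.coe_linearMapAt_of_mem e ha]
    exact (e.linearEquivAt ℝ a.1 ha).injective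
  -- `Ψ` gives coordinates in which the frame at `a`, completed by `b`, becomes the standard basis.
  obtain ⟨Ψ, hΨ⟩ := exists_dual_family hWF
  set V : TotalSpace F E → Fin (k + 1) → F := fun c =>
    Fin.snoc (fun i => (e ⟨c.1, s i c.1⟩).2) (e c).2 with hV
  set g : TotalSpace F E → ℝ := fun c => Matrix.det (Matrix.of fun i j => Ψ (V c j) i) with hg
  have hsrc : e.source ∈ 𝓝 a := e.open_source.mem_nhds (e.mem_source.2 ha)
  have hgs : ContMDiffAt (totalModel n F) 𝓘(ℝ, ℝ) ∞ g a := by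
    refine (contDiff_matrix_det (k + 1)).contMDiff.contMDiffAt.comp a ?_
    refine contMDiffAt_pi_space.2 fun i => contMDiffAt_pi_space.2 fun j => ?_
    have hVj : ContMDiffAt (totalModel n F) 𝓘(ℝ, F) ∞ (fun c => V c j) a := by
      refine Fin.lastCases ?_ (fun j => ?_) j
      · simp only [hV, Fin.snoc_last]
        exact contMDiffAt_snd.comp a ((e.contMDiffOn (IB := 𝓡 n) (n := ∞)).contMDiffAt hsrc)
      · simp only [hV, Fin.snoc_castSucc]
        have h1 := ((hs j).contMDiffAt (hU.mem_nhds haU))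
        have h2 := (e.contMDiffAt_section_iff ha).1 h1
        exact h2.comp a (contMDiffAt_proj E)
    have hΨs : ContMDiff 𝓘(ℝ, F) 𝓘(ℝ, ℝ) ∞ (fun y : F => Ψ y i) :=
      ((contDiff_pi.1 Ψ.contDiff) i).contMDiff
    exact hΨs.contMDiffAt.comp a hVj
  have hg0 : ∀ᶠ c in 𝓝[totalSet F D] a, g c = 0 := by
    have hUE : (TotalSpace.proj : TotalSpace F E → M) ⁻¹' U ∈ 𝓝 a :=
      (hU.preimage (FiberBundle.continuous_proj F E)).mem_nhds haU
    filter_upwards [self_mem_nhdsWithin, mem_nhdsWithin_of_mem_nhds hUE,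
      mem_nhdsWithin_of_mem_nhds hsrc] with c hcD hcU hcs
    have hcs' := e.mem_source.1 hcs
    have hcD' : c.2 ∈ Submodule.span ℝ (range fun i => s i c.1) := by
      rw [(hsD c.1 hcU).2]; exact hcD
    obtain ⟨r, hr⟩ := (Submodule.mem_span_range_iff_exists_fun ℝ).1 hcD'
    -- On `D` the last column is the combination `r` of the others, so `(-r, 1)` is in the kernel.
    refine Matrix.exists_mulVec_eq_zero_iff.1 ⟨Fin.snoc (fun i => -r i) 1, fun h => ?_, ?_⟩
    · simpa using congrFun h (Fin.last k)
    · funext i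
      have h1 : (e c).2 = ∑ j, r j • (e ⟨c.1, s j c.1⟩).2 := by
        refine (he hcs' c.2).trans ?_
        simp only [he hcs', ← hr, map_sum, map_smul]
      simp [Matrix.mulVec, dotProduct, Fin.sum_univ_castSucc, hV, h1, mul_comm]
  have hcurve : ∀ t : ℝ, g ⟨a.1, a.2 + t • b⟩ =
      Matrix.det (Matrix.updateCol 1 (Fin.last k) (Ψ (e a).2)) + t := by
    intro t
    -- Along the fibre curve the frame columns stay fixed at the standard basis, and only the last
    -- column moves; the determinant is affine in `t` with slope `det 1 = 1`.
    have hM : (Matrix.of fun i j => Ψ (V ⟨a.1, a.2 + t • b⟩ j) i) =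
        Matrix.updateCol 1 (Fin.last k)
          (Ψ (e a).2 + t • fun i => (1 : Matrix (Fin (k + 1)) (Fin (k + 1)) ℝ) i (Fin.last k)) := by
      ext i j
      refine Fin.lastCases ?_ (fun j => ?_) j
      · have h1 := congrFun (hΨ (Fin.last k)) i
        simp only [hWdef, Fin.snoc_last] at h1
        simp [hV, he ha, h1, Matrix.one_apply, Pi.single_apply]
      · have h1 := congrFun (hΨ j.castSucc) i
        simp only [hWdef, Fin.snoc_castSucc] at h1
        simp [hV, he ha, h1, Matrix.one_apply, Pi.single_apply,
          (Fin.castSucc_lt_last j).ne]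
    simp only [hg]
    rw [hM, Matrix.det_updateCol_add, Matrix.det_updateCol_smul, Matrix.updateCol_eq_self,
      Matrix.det_one, mul_one]
  have h0 : (fun t : ℝ => (⟨a.1, a.2 + t • b⟩ : TotalSpace F E)) 0 = a := by simp
  have h1 := (mvfderiv_comp_apply_of_eq (0 : ℝ) (hgs.mdifferentiableAt (by simp))
    (mdifferentiableAt_fiberCurve (n := n) a b) h0 (1 : ℝ)).trans (hb g hgs hg0)
  have h2 : (g ∘ fun t : ℝ => (⟨a.1, a.2 + t • b⟩ : TotalSpace F E)) =
      fun t => Matrix.det (Matrix.updateCol 1 (Fin.last k) (Ψ (e a).2)) + t := funext hcurve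
  rw [h2] at h1
  have h3 : fderiv ℝ (fun t : ℝ =>
      Matrix.det (Matrix.updateCol 1 (Fin.last k) (Ψ (e a).2)) + t) 0 1 = 0 := by
    rw [← mfderiv_eq_fderiv]
    exact h1
  simp at h3

/-! ### Vertical elements and lifts in the prolongation. -/

theorem finiteDimensional_prolong [FiniteDimensional ℝ F] (A : LieAlgebroid n F E)
    (a : TotalSpace F E) : FiniteDimensional ℝ (prolong A a) := by
  have h1 : FiniteDimensional ℝ (E a.1) :=
    ((trivializationAt F E a.1).linearEquivAt ℝ a.1
      (FiberBundle.mem_baseSet_trivializationAt' a.1)).symm.finiteDimensional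
  have h2 : FiniteDimensional ℝ (TangentSpace (totalModel n F) a) :=
    inferInstanceAs (FiniteDimensional ℝ (EuclideanSpace ℝ (Fin n) × F))
  infer_instance

/-- The vertical lift as a map into the prolongation. -/
def prolongVertical (A : LieAlgebroid n F E) (a : TotalSpace F E) : E a.1 →ₗ[ℝ] prolong A a :=
  (LinearMap.inr ℝ (E a.1) (TangentSpace (totalModel n F) a) ∘ₗ verticalLiftₗ n a).codRestrict
    (prolong A a) fun b => by
      change A.anchor a.1 0 = mfderiv (totalModel n F) (𝓡 n) TotalSpace.proj a (verticalLiftₗ n a b)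
      rw [map_zero, verticalLiftₗ_apply, mfderiv_proj_verticalLift]

theorem prolongVertical_snd (A : LieAlgebroid n F E) (a : TotalSpace F E) (b : E a.1) :
    (prolongVertical A a b).1.2 = verticalLift n a b := verticalLiftₗ_apply a b

theorem prolongVertical_injective (A : LieAlgebroid n F E) (a : TotalSpace F E) :
    Function.Injective (prolongVertical A a) := fun b c h => by
  refine verticalLift_injective (n := n) a ?_
  rw [← prolongVertical_snd A, ← prolongVertical_snd A, h]

theorem exists_prolongVertical_eq (A : LieAlgebroid n F E) (a : TotalSpace F E) (z : prolong A a)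
    (hz : z.1.1 = 0) : ∃ b, prolongVertical A a b = z := by
  have h : A.anchor a.1 z.1.1 =
    mfderiv (totalModel n F) (𝓡 n) (TotalSpace.proj : TotalSpace F E → M) a z.1.2 := z.2
  rw [hz, map_zero] at h
  obtain ⟨b, hb⟩ := exists_verticalLift_eq a z.1.2 h.symm
  exact ⟨b, Subtype.ext (Prod.ext hz.symm ((prolongVertical_snd A a b).trans hb))⟩

theorem prolongVertical_mem_iff [FiniteDimensional ℝ F] (A : LieAlgebroid n F E)
    (hD : IsSmoothSubbundle (F := F) n D) {a : TotalSpace F E} (ha : a.2 ∈ D a.1) (b : E a.1) :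
    prolongVertical A a b ∈ prolongConstr A D a ↔ b ∈ D a.1 := by
  constructor
  · intro h
    refine mem_of_verticalLift_mem_tangentTo hD (n := n) (a := a) ?_
    rw [← prolongVertical_snd A]
    exact h.2
  · intro h
    refine ⟨(D a.1).zero_mem, ?_⟩
    change (prolongVertical A a b).1.2 ∈ tangentTo n D a
    rw [prolongVertical_snd]
    exact verticalLift_mem_tangentTo ha h

theorem exists_tangent_lift (A : LieAlgebroid n F E) (hD : IsSmoothSubbundle (F := F) n D)
    {a : TotalSpace F E} (ha : a.2 ∈ D a.1) (c : E a.1) :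
    ∃ u : prolong A a, u.1.1 = c ∧ u.1.2 ∈ tangentTo n D a := by
  obtain ⟨v, hv, hvc⟩ := exists_mem_tangentTo hD ha (A.anchor a.1 c)
  exact ⟨⟨(c, v), hvc.symm⟩, rfl, hv⟩

/-! ### The direct sum decomposition and the projected dynamics. -/

/-- A vertical vector over `D` whose contraction with `ω_L` annihilates the lifts of `D` vanishes,
because the Lagrange-d'Alembert equations at `a` have a unique solution. -/
theorem eq_zero_of_vertical_orthogonal [T2Space M] [FiniteDimensional ℝ F] (A : LieAlgebroid n F E)
    (L : TotalSpace F E → ℝ) (hD : IsSmoothSubbundle (F := F) n D) {a : TotalSpace F E}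
    (ha : a.2 ∈ D a.1) {z₀ : prolong A a} (hz₀ : LagrangeDAlembertAt A L D a z₀)
    (huniq : ∀ z, LagrangeDAlembertAt A L D a z → z = z₀) {w : E a.1} (hw : w ∈ D a.1)
    (hwD : ∀ u : prolong A a, u.1.1 ∈ D a.1 →
      cartanTwoForm A L a (prolongVertical A a w) u = 0) : w = 0 := by
  let p : prolong A a →ₗ[ℝ] E a.1 := LinearMap.fst ℝ _ _ ∘ₗ (prolong A a).subtype
  have hp : LinearMap.range p = ⊤ := LinearMap.range_eq_top.2 fun c =>
    (exists_tangent_lift A hD ha c).imp fun _ h => h.1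
  obtain ⟨r, hr⟩ := p.exists_rightInverse_of_surjective hp
  obtain ⟨h1, ⟨l, hl, hlu⟩, h3⟩ := hz₀
  have hpr : ∀ c, (r c).1.1 = c := fun c => LinearMap.congr_fun hr c
  have key : z₀ + prolongVertical A a w = z₀ := by
    -- `S` ignores vertical elements, and the multiplier absorbs the functional `c ↦ ω_L(V(w), r
    -- c)`, which lies in `D°` by `hwD`.
    refine huniq _ ⟨?_, ⟨l + cartanTwoForm A L a (prolongVertical A a w) ∘ₗ r, ?_, fun u => ?_⟩, ?_⟩
    · rw [← h1]
      unfold vertEndo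
      refine congrArg (fun c => ((0 : E a.1), verticalLift n a c)) ?_
      exact add_zero z₀.1.1
    · refine Submodule.add_mem _ hl ((Submodule.mem_dualAnnihilator _).2 fun c hc => ?_)
      exact hwD _ (by rwa [hpr])
    -- `u` and the lift of its `E`-component differ by a vertical element, invisible to `V(w)`.
    · have hru : cartanTwoForm A L a (prolongVertical A a w) (u - r u.1.1) = 0 := by
        refine cartanTwoForm_vertical A L a _ _ rfl ?_
        change u.1.1 - (r u.1.1).1.1 = 0
        rw [hpr, sub_self]
      rw [map_sub, sub_eq_zero] at hru
      rw [map_add, LinearMap.add_apply, hru, LinearMap.add_apply, ← hlu u]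
      simp only [LinearMap.comp_apply]
      ring
    · exact Submodule.add_mem _ h3 ((prolongVertical_mem_iff A hD ha w).2 hw)
  have h0 : prolongVertical A a w = 0 := by simpa using key
  exact prolongVertical_injective A a (h0.trans (map_zero _).symm)

theorem isCompl_prolongConstr [T2Space M] [FiniteDimensional ℝ F] (A : LieAlgebroid n F E)
    (L : TotalSpace F E → ℝ) (hD : IsSmoothSubbundle (F := F) n D) {a : TotalSpace F E}
    (ha : a.2 ∈ D a.1) {z₀ : prolong A a} (hz₀ : LagrangeDAlembertAt A L D a z₀)
    (huniq : ∀ z, LagrangeDAlembertAt A L D a z → z = z₀) :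
    IsCompl (prolongConstr A D a) (prolongPerp A L D a) := by
  have hfin := finiteDimensional_prolong A a
  have hfinE : FiniteDimensional ℝ (E a.1) :=
    Module.Finite.of_injective (prolongVertical A a) (prolongVertical_injective A a)
  have hzero : ∀ {w : E a.1}, w ∈ D a.1 → (∀ u : prolong A a, u.1.1 ∈ D a.1 →
      cartanTwoForm A L a (prolongVertical A a w) u = 0) → w = 0 :=
    eq_zero_of_vertical_orthogonal A L hD ha hz₀ huniq
  -- It remains to show that `ω_L` restricts to a nondegenerate form on `T^D D`.
  refine (LinearMap.BilinForm.isCompl_orthogonal_iff_disjoint (cartanTwoForm_isRefl A L a)).2 ?_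
  rw [Submodule.disjoint_def]
  intro z hz hzP
  have hzP' : ∀ u ∈ prolongConstr A D a, cartanTwoForm A L a z u = 0 := fun u hu => by
    rw [cartanTwoForm_swap, LinearMap.BilinForm.mem_orthogonal_iff.1 hzP u hu, neg_zero]
  let p : prolongConstr A D a →ₗ[ℝ] D a.1 :=
    (LinearMap.fst ℝ _ _ ∘ₗ (prolong A a).subtype ∘ₗ (prolongConstr A D a).subtype).codRestrict
      (D a.1) fun u => u.2.1
  have hp : LinearMap.range p = ⊤ := LinearMap.range_eq_top.2 fun c => by
    obtain ⟨u, hu, hut⟩ := exists_tangent_lift A hD ha c.1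
    exact ⟨⟨u, by change u.1.1 ∈ D a.1; rw [hu]; exact c.2, hut⟩, Subtype.ext hu⟩
  obtain ⟨r, hr⟩ := p.exists_rightInverse_of_surjective hp
  have hpr : ∀ c : D a.1, (r c).1.1.1 = c.1 := fun c =>
    congrArg Subtype.val (LinearMap.congr_fun hr c)
  -- The lifts `r c` are chosen inside `T^D D`, so that `G w` can be evaluated both on arbitrary
  -- elements over `D` (`hGu`) and by orthogonality to `T^D D`.
  let G : D a.1 →ₗ[ℝ] Module.Dual ℝ (D a.1) :=
    (cartanTwoForm A L a).compl₁₂ (prolongVertical A a ∘ₗ (D a.1).subtype)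
      ((prolongConstr A D a).subtype ∘ₗ r)
  have hGu : ∀ (w : D a.1) (u : prolong A a) (hu : u.1.1 ∈ D a.1),
      cartanTwoForm A L a (prolongVertical A a w) u = G w ⟨u.1.1, hu⟩ := by
    intro w u hu
    have hru : cartanTwoForm A L a (prolongVertical A a w) (u - (r ⟨u.1.1, hu⟩).1) = 0 := by
      refine cartanTwoForm_vertical A L a _ _ rfl ?_
      change u.1.1 - (r ⟨u.1.1, hu⟩).1.1.1 = 0
      rw [hpr, sub_self]
    rwa [map_sub, sub_eq_zero] at hru
  have hGinj : Function.Injective G := by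
    refine (injective_iff_map_eq_zero G).2 fun w hw => Subtype.ext (hzero w.2 fun u hu => ?_)
    rw [hGu w u hu, hw]
    rfl
  have hGsurj : Function.Surjective G :=
    (LinearMap.injective_iff_surjective_of_finrank_eq_finrank
      (Subspace.dual_finrank_eq (K := ℝ) (V := D a.1)).symm).1 hGinj
  have hz1 : z.1.1 = 0 := by
    have : (⟨z.1.1, hz.1⟩ : D a.1) = 0 := by
      -- Every functional on `D` is some `G w`, and its value on the `E`-component of `z` is
      -- `ω_L(V(w), z) = 0`, because `V(w) ∈ T^D D`.
      refine (Module.forall_dual_apply_eq_zero_iff ℝ _).1 fun φ => ?_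
      obtain ⟨w, rfl⟩ := hGsurj φ
      rw [← hGu w z hz.1, cartanTwoForm_swap,
        hzP' _ ((prolongVertical_mem_iff A hD ha _).2 w.2), neg_zero]
    exact congrArg Subtype.val this
  obtain ⟨w, rfl⟩ := exists_prolongVertical_eq A a z hz1
  have hw := (prolongVertical_mem_iff A hD ha w).1 hz
  have hw0 : w = 0 := hzero hw fun u hu => by
    rw [hGu ⟨w, hw⟩ u hu]
    exact hzP' _ (r _).2
  rw [hw0, map_zero]

/-- The difference `w - z` pairs with `u` to `-l(u.1.1)`, which is zero on `T^D D`; so `w = z + (w -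
z)` is the decomposition of `w`. -/
theorem projector_freeSolution [T2Space M] (A : LieAlgebroid n F E)
    (L : TotalSpace F E → ℝ) {a : TotalSpace F E} {z w : prolong A a}
    (hz : LagrangeDAlembertAt A L D a z)
    (hw : ∀ u : prolong A a, cartanTwoForm A L a w u = dFun n (energy n L) a u)
    (hc : IsCompl (prolongConstr A D a) (prolongPerp A L D a)) :
    projector A L D a w = z := by
  obtain ⟨-, ⟨l, hl, hlu⟩, hzD⟩ := hz
  have hperp : w - z ∈ prolongPerp A L D a := by
    refine LinearMap.BilinForm.mem_orthogonal_iff.2 fun u hu => ?_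
    have h1 := hlu u
    have h2 : l u.1.1 = 0 := (Submodule.mem_dualAnnihilator l).1 hl _ hu.1
    rw [← hw u, h2] at h1
    rw [cartanTwoForm_swap, map_sub, LinearMap.sub_apply]
    linarith
  unfold projector
  rw [dif_pos hc]
  have h := map_add ((prolongConstr A D a).projection (prolongPerp A L D a) hc) z (w - z)
  rw [add_sub_cancel, Submodule.projection_apply_of_mem_left hc hzD,
    (Submodule.projection_apply_eq_zero_iff hc).2 hperp, add_zero] at h
  exact h

end Nonholonomic

end

theorem mainTheorem3 {n : ℕ} {F : Type*} [NormedAddCommGroup F] [NormedSpace ℝ F]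
    [FiniteDimensional ℝ F]
    {M : Type*} [TopologicalSpace M] [T2Space M] [SecondCountableTopology M]
    [ChartedSpace (EuclideanSpace ℝ (Fin n)) M] [IsManifold (𝓡 n) ∞ M]
    {E : M → Type*} [∀ x, AddCommGroup (E x)] [∀ x, Module ℝ (E x)]
    [∀ x, TopologicalSpace (E x)] [TopologicalSpace (TotalSpace F E)]
    [FiberBundle F E] [VectorBundle ℝ F E] [ContMDiffVectorBundle ∞ F E (𝓡 n)]
    (A : Nonholonomic.LieAlgebroid n F E)
    (L : TotalSpace F E → ℝ) (hL : ContMDiff (Nonholonomic.totalModel n F) 𝓘(ℝ, ℝ) ∞ L)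
    (D : ∀ x, Submodule ℝ (E x)) (hD : Nonholonomic.IsSmoothSubbundle (F := F) n D)
    (U : Set (TotalSpace F E)) (hU : IsOpen U) (hDU : Nonholonomic.totalSet F D ⊆ U)
    (hLreg : ∀ a ∈ U, (Nonholonomic.cartanTwoForm A L a).Nondegenerate)
    (hreg : Nonholonomic.IsRegularSystem A L D)
    (ΓL : ∀ a : TotalSpace F E, Nonholonomic.prolong A a)
    (hΓL : Nonholonomic.IsFreeSolution A L U ΓL) :
    (∀ a ∈ Nonholonomic.totalSet F D,
      IsCompl (Nonholonomic.prolongConstr A D a) (Nonholonomic.prolongPerp A L D a)) ∧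
    Nonholonomic.IsConstrainedSolution A L D
      (fun a => Nonholonomic.projector A L D a (ΓL a)) ∧
    ∀ Γ : ∀ a : TotalSpace F E, Nonholonomic.prolong A a,
      Nonholonomic.IsConstrainedSolution A L D Γ →
        ∀ a ∈ Nonholonomic.totalSet F D, Γ a = Nonholonomic.projector A L D a (ΓL a) := by
  obtain ⟨Γ₀, hΓ₀, huniq⟩ := hreg
  have hc : ∀ a ∈ Nonholonomic.totalSet F D,
      IsCompl (Nonholonomic.prolongConstr A D a) (Nonholonomic.prolongPerp A L D a) :=
    fun a ha => Nonholonomic.isCompl_prolongConstr A L hD ha (hΓ₀.2 a ha) (huniq a ha)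
  have hP : ∀ Γ : ∀ a : TotalSpace F E, Nonholonomic.prolong A a,
      Nonholonomic.IsConstrainedSolution A L D Γ →
        ∀ a ∈ Nonholonomic.totalSet F D, Γ a = Nonholonomic.projector A L D a (ΓL a) :=
    fun Γ hΓ a ha => (Nonholonomic.projector_freeSolution A L (hΓ.2 a ha)
      (hΓL.2 a (hDU ha)) (hc a ha)).symm
  -- The projected section agrees on `D` with the given solution `Γ₀`, from which it inherits
  -- smoothness and the equations.
  refine ⟨hc, ⟨⟨hΓ₀.1.1.congr fun a ha => ?_, hΓ₀.1.2.congr fun a ha => ?_⟩, fun a ha => ?_⟩, hP⟩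
  · rw [hP Γ₀ hΓ₀ a ha]
  · rw [hP Γ₀ hΓ₀ a ha]
  · beta_reduce
    rw [← hP Γ₀ hΓ₀ a ha]
    exact hΓ₀.2 a ha
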